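/- \textbf{(Duality theorem for the nested Sinkhorn divergence.)} Let $\Xi,\tilde\Xi$ be finite sets (the leaves of two scenario trees of height $T$), with filtrations $\mathcal F_0\subset\dots\subset\mathcal F_T$ and $\tilde{\mathcal F}_0\subset\dots\subset\tilde{\mathcal F}_T$, where $\mathcal F_0,\tilde{\mathcal F}_0$ are trivial and $\mathcal F_T,\tilde{\mathcal F}_T$ are the power sets, and with probability measures $P$ on $\Xi$, $\tilde P$ on $\tilde\Xi$ that charge every point. For $i\in\Xi$ let $i_t$ be the atom of $\mathcal F_t$ containing $i$ (the node of stage $t$ above the leaf $i$), and define $j_t$ for $j\in\tilde\Xi$ in the same way. Let $r\ge1$, $\lambda>0$ and let $d\colon\Xi\times\tilde\Xi\to\mathbb R$ be a distance or any other cost function (at negative values of $d$, if any, $x^r$ is the real part of the principal power). Let $\boldsymbol{de}^r$ be the optimal value (infimum) of the entropy-regularized nested problem \begin{align*} \text{minimize in }\pi\quad &\sum_{i,j}\Big(\pi_{ij}\,d(i,j)^r+\tfrac1\lambda\,\pi_{ij}\log\pi_{ij}\Big)\\ \text{subject to}\quad &\frac{\sum_{j'\in j_t}\pi_{ij'}}{\sum_{i'\in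 i_t,\,j'\in j_t}\pi_{i'j'}}=\frac{P(\{i\})}{P(i_t)},\qquad \frac{\sum_{i'\in i_t}\pi_{i'j}}{\sum_{i'\in i_t,\,j'\in j_t}\pi_{i'j'}}=\frac{\tilde P(\{j\})}{\tilde P(j_t)}\qquad (i\in\Xi,\ j\in\tilde\Xi,\ 0\le t\le T),\\ &\pi_{ij}>0\ \text{ for all } i,j,\qquad \sum_{i,j}\pi_{ij}=1 . \end{align*} For $f\colon\Xi\times\tilde\Xi\to\mathbb R$ put $(\operatorname{proj}_t f)(\xi,\tilde\xi)=\mathbb E_P\big(f(\cdot,\tilde\xi)\mid\mathcal F_t\big)(\xi)$ and $(\widetilde{\operatorname{proj}}_t f)(\xi,\tilde\xi)=\mathbb E_{\tilde P}\big(f(\xi,\cdot)\mid\tilde{\mathcal F}_t\big)(\tilde\xi)$. Consider all real numbers $M_0$ for which there is a process of the form $$M_t=M_0+\sum_{s=1}^t\big(\hat\beta_s+\hat\gamma_s\big),\qquad t=0,\dots,T,$$ where $\hat\beta_t$ is $\mathcal F_t\otimes\tilde{\mathcal F}_{t-1}$-measurable with $\operatorname{proj}_{t-1}(\hat\beta_t)=0$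 and $\hat\gamma_t$ is $\mathcal F_{t-1}\otimes\tilde{\mathcal F}_t$-measurable with $\widetilde{\operatorname{proj}}_{t-1}(\hat\gamma_t)=0$ for $t=1,\dots,T$, such that $$(\xi,\tilde\xi)\mapsto\exp\!\big(-\lambda\,(d(\xi,\tilde\xi)^r-M_T(\xi,\tilde\xi))-1\big)$$ are the point masses of a probability measure on $\Xi\times\tilde\Xi$. Then the feasible set of the minimization problem is nonempty, $\boldsymbol{de}^r$ is finite, and the supremum of all such $M_0$ is $$\sup M_0=\boldsymbol{de}^r+\frac1\lambda,\qquad\text{that is,}\qquad \boldsymbol{de}^r=\sup M_0-\frac1\lambda .$$ -/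

import Mathlib

open MeasureTheory

/-- The node of stage `t` lying above the leaf `x`: the atom of the `σ`-algebra `F t` that
contains `x`. A filtration of a finite set is the same thing as a tree whose leaves are the points
of the set and whose nodes at stage `t` are the atoms of `F t`. -/
def stageNode {Ω : Type*} {m : MeasurableSpace Ω} (F : Filtration ℕ m) (t : ℕ) (x : Ω) : Set Ω :=
  @measurableAtom Ω (F t) x

open Classical in
/-- The total mass that the plan `π` gives to the pair of nodes `(A, B)`. -/
noncomputable def nodeMass {Ω Ω' : Type*} [Fintype Ω] [Fintype Ω'] (π : Ω → Ω' → ℝ)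
    (A : Set Ω) (B : Set Ω') : ℝ :=
  ∑ x with x ∈ A, ∑ y with y ∈ B, π x y

/-- The conditional plan `π (i, j ∣ A, B)` for leaves `i` of the node `A` and `j` of the
node `B`. -/
noncomputable def condPlan {Ω Ω' : Type*} [Fintype Ω] [Fintype Ω'] (π : Ω → Ω' → ℝ)
    (A : Set Ω) (B : Set Ω') (i : Ω) (j : Ω') : ℝ :=
  π i j / nodeMass π A B

open Classical in
/-- Feasibility of a plan `π` for the entropy-regularized nested problem with stages `0, …, T`.
The node of stage `t` on the first (second) tree is written as the one above the leaf `i` (`j`);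
as `i` and `j` run through all leaves, all pairs of nodes are covered. -/
structure IsNestedPlan {Ω Ω' : Type*} [Fintype Ω] [Fintype Ω']
    {m : MeasurableSpace Ω} {m' : MeasurableSpace Ω'} (T : ℕ)
    (F : Filtration ℕ m) (F' : Filtration ℕ m') (P : Measure Ω) (P' : Measure Ω')
    (π : Ω → Ω' → ℝ) : Prop where
  pos : ∀ i j, 0 < π i j
  sum_eq_one : ∑ i, ∑ j, π i j = 1
  left_marginal : ∀ t ≤ T, ∀ i j,
    ∑ y with y ∈ stageNode F' t j, condPlan π (stageNode F t i) (stageNode F' t j) i y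
      = P.real {i} / P.real (stageNode F t i)
  right_marginal : ∀ t ≤ T, ∀ i j,
    ∑ x with x ∈ stageNode F t i, condPlan π (stageNode F t i) (stageNode F' t j) x j
      = P'.real {j} / P'.real (stageNode F' t j)

/-- The objective `∑ π d ^ r + (1 / l) ∑ π log π`, with `l` the regularization parameter. -/
noncomputable def entropicCost {Ω Ω' : Type*} [Fintype Ω] [Fintype Ω'] (l r : ℝ)
    (d : Ω → Ω' → ℝ) (π : Ω → Ω' → ℝ) : ℝ :=
  ∑ i, ∑ j, (π i j * d i j ^ r + 1 / l * (π i j * Real.log (π i j)))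

/-- The values of the objective at the feasible plans. -/
def nestedSinkhornValues {Ω Ω' : Type*} [Fintype Ω] [Fintype Ω']
    {m : MeasurableSpace Ω} {m' : MeasurableSpace Ω'} (T : ℕ)
    (F : Filtration ℕ m) (F' : Filtration ℕ m') (P : Measure Ω) (P' : Measure Ω')
    (l r : ℝ) (d : Ω → Ω' → ℝ) : Set ℝ :=
  entropicCost l r d '' {π | IsNestedPlan T F F' P P' π}

/-- The nested Sinkhorn divergence including the entropy: the optimal value of the
entropy-regularized nested problem. -/
noncomputable def nestedSinkhorn {Ω Ω' : Type*} [Fintype Ω] [Fintype Ω']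
    {m : MeasurableSpace Ω} {m' : MeasurableSpace Ω'} (T : ℕ)
    (F : Filtration ℕ m) (F' : Filtration ℕ m') (P : Measure Ω) (P' : Measure Ω')
    (l r : ℝ) (d : Ω → Ω' → ℝ) : ℝ :=
  sInf (nestedSinkhornValues T F F' P P' l r d)

/-- The projection which takes the `P`-conditional expectation given `F t` in the first
coordinate; it maps `β (x) * γ (y)` to `E (β ∣ F t) (x) * γ (y)`. -/
noncomputable def projLeft {Ω Ω' : Type*} {m : MeasurableSpace Ω} (F : Filtration ℕ m)
    (P : Measure Ω) (t : ℕ) (f : Ω × Ω' → ℝ) : Ω × Ω' → ℝ :=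
  fun z => (P[fun x => f (x, z.2) | F t]) z.1

/-- The projection which takes the `P'`-conditional expectation given `F' t` in the second
coordinate; it maps `β (x) * γ (y)` to `β (x) * E (γ ∣ F' t) (y)`. -/
noncomputable def projRight {Ω Ω' : Type*} {m' : MeasurableSpace Ω'} (F' : Filtration ℕ m')
    (P' : Measure Ω') (t : ℕ) (f : Ω × Ω' → ℝ) : Ω × Ω' → ℝ :=
  fun z => (P'[fun y => f (z.1, y) | F' t]) z.2

/-- `M` is, up to time `T`, a process `M t = M₀ + ∑ s ∈ {1, …, t}, (β s + γ s)` with `β s`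
measurable for `F s ⊗ F' (s - 1)`, `γ s` measurable for `F (s - 1) ⊗ F' s`, and both with
vanishing projections at time `s - 1`. -/
def IsDualProcess {Ω Ω' : Type*} {m : MeasurableSpace Ω} {m' : MeasurableSpace Ω'} (T : ℕ)
    (F : Filtration ℕ m) (F' : Filtration ℕ m') (P : Measure Ω) (P' : Measure Ω')
    (M₀ : ℝ) (M : ℕ → Ω × Ω' → ℝ) : Prop :=
  ∃ β γ : ℕ → Ω × Ω' → ℝ,
    (∀ t ∈ Finset.Icc 1 T,
      Measurable[(F t).prod (F' (t - 1))] (β t) ∧ projLeft F P (t - 1) (β t) = 0 ∧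
      Measurable[(F (t - 1)).prod (F' t)] (γ t) ∧ projRight F' P' (t - 1) (γ t) = 0) ∧
    ∀ t ≤ T, ∀ z, M t z = M₀ + ∑ s ∈ Finset.Icc 1 t, (β s z + γ s z)

/-- `q` is the matrix of point masses of a probability measure on the finite set `Ω × Ω'`. -/
def IsProbabilityMass {Ω Ω' : Type*} [Fintype Ω] [Fintype Ω'] (q : Ω × Ω' → ℝ) : Prop :=
  (∀ z, 0 ≤ q z) ∧ ∑ z, q z = 1

/-- The numbers `M₀` that are starting values of admissible dual processes. -/
def dualStartValues {Ω Ω' : Type*} [Fintype Ω] [Fintype Ω']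
    {m : MeasurableSpace Ω} {m' : MeasurableSpace Ω'} (T : ℕ)
    (F : Filtration ℕ m) (F' : Filtration ℕ m') (P : Measure Ω) (P' : Measure Ω')
    (l r : ℝ) (d : Ω → Ω' → ℝ) : Set ℝ :=
  {M₀ | ∃ M : ℕ → Ω × Ω' → ℝ, IsDualProcess T F F' P P' M₀ M ∧
    IsProbabilityMass fun z : Ω × Ω' => Real.exp (-l * (d z.1 z.2 ^ r - M T z) - 1)}

/-!
# Duality for the entropy-regularized nested transport problem

For positive `π` the marginal constraints are linear (`IsNodeBalanced`), so the primal problem is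
the minimization of a continuous convex function over the positive points of a polytope. Let `S` be
the space of terminal values `M T` of dual processes (`dualTerminalValues`).

*Weak duality.* A nested plan integrates every increment `β t`, `γ t` to zero, since on a pair of
nodes of stage `t - 1` the increment depends on one leaf only and has conditional mean zero there.
Hence `∑ π M T = M₀` (`IsRelaxedNestedPlan.sum_mul_terminalValue`). Gibbs' inequality between `π`
and the probability `exp (-l (d ^ r - M T) - 1)` then reads `M₀ ≤ cost π + 1 / l`.

*Attainment.* Allowing vanishing entries makes the feasible set compact, so a minimizer exists. It
is positive, because the entropy has slope `-∞` at vanishing entries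
(`IsRelaxedNestedPlan.pos_of_isMinOn`); so it is feasible for the original problem, and the gradient
`G = d ^ r + (1 / l) (log π + 1)` annihilates all directions that preserve the constraints.

*Strong duality.* The annihilator of these directions is `S`
(`mem_dualTerminalValues_of_forall`): the constraint attached to the leaf `i` and the node `B` of
stage `t` is the linear form `g ⊗ 1_B`, where `g` is the fluctuation of the indicator of `i` around
its conditional mean at stage `t`. The martingale differences of `g` vanish up to time `t`, and
afterwards `1_B` is known one step ahead, so `g ⊗ 1_B` lies in `S`
(`mul_mem_dualTerminalValues`). Thus `G = M T` for a dual process `M`. For it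
`exp (-l (d ^ r - M T) - 1) = π` is a probability, and `M₀ = ∑ π G = cost π + 1 / l`, so the bound
of weak duality is attained.
-/

/-! ### Nodes of the trees and conditional expectations on them -/

section Nodes

variable {Ω : Type*} {m : MeasurableSpace Ω} (F : Filtration ℕ m)

lemma mem_stageNode_self (t : ℕ) (x : Ω) : x ∈ stageNode F t x :=
  @mem_measurableAtom_self Ω (F t) x

variable {F}

lemma stageNode_subset {t : ℕ} {s : Set Ω} {x : Ω} (hs : MeasurableSet[F t] s) (hx : x ∈ s) :
    stageNode F t x ⊆ s :=
  @measurableAtom_subset Ω (F t) s x hs hx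

lemma measurableSet_stageNode [Countable Ω] (t : ℕ) (x : Ω) :
    MeasurableSet[F t] (stageNode F t x) :=
  @MeasurableSet.measurableAtom_of_countable Ω (F t) _ x

lemma stageNode_eq_of_mem {t : ℕ} {x y : Ω} (h : y ∈ stageNode F t x) :
    stageNode F t y = stageNode F t x :=
  @measurableAtom_eq_of_mem Ω (F t) _ _ h

lemma eq_of_mem_stageNode {t : ℕ} {f : Ω → ℝ} (hf : Measurable[F t] f) {x y : Ω}
    (h : y ∈ stageNode F t x) : f y = f x :=
  stageNode_subset (s := f ⁻¹' {f x}) (hf (measurableSet_singleton _)) rfl h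

open Classical in
/-- The nodes of a stage partition the leaves. -/
lemma sum_eq_zero_of_forall_stageNode [Fintype Ω] (t : ℕ) {f : Ω → ℝ}
    (h : ∀ x, ∑ y with y ∈ stageNode F t x, f y = 0) : ∑ x, f x = 0 := by
  rw [← Finset.sum_fiberwise Finset.univ (stageNode F t) f]
  refine Finset.sum_eq_zero fun B _ => ?_
  by_cases hB : ∃ x, stageNode F t x = B
  · obtain ⟨x, rfl⟩ := hB
    rw [← h x]
    refine Finset.sum_congr (Finset.filter_congr fun y _ => ⟨fun hy => ?_, stageNode_eq_of_mem⟩)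
      fun _ _ => rfl
    rw [← hy]
    exact mem_stageNode_self F t y
  · refine Finset.sum_eq_zero fun y hy => absurd ⟨y, (Finset.mem_filter.mp hy).2⟩ hB

end Nodes

section FullSupport

variable {Ω : Type*} {m : MeasurableSpace Ω} {P : Measure Ω}

lemma eq_of_ae_eq_of_forall_pos (hP : ∀ i, 0 < P {i}) {f g : Ω → ℝ} (h : f =ᵐ[P] g) : f = g := by
  funext i
  by_contra hi
  exact (hP i).ne' (measure_mono_null (Set.singleton_subset_iff.mpr hi) (ae_iff.mp h))

variable [IsProbabilityMeasure P]

lemma condExp_condExp (hP : ∀ i, 0 < P {i}) (F : Filtration ℕ m) {s t : ℕ} (hst : s ≤ t)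
    (f : Ω → ℝ) : P[P[f | F t] | F s] = P[f | F s] :=
  eq_of_ae_eq_of_forall_pos hP (condExp_condExp_of_le (F.mono hst) (F.le t))

lemma real_stageNode_pos (hP : ∀ i, 0 < P {i}) (F : Filtration ℕ m) (t : ℕ) (i : Ω) :
    0 < P.real (stageNode F t i) :=
  (ENNReal.toReal_pos (hP i).ne' (measure_ne_top _ _)).trans_le
    (measureReal_mono (Set.singleton_subset_iff.mpr (mem_stageNode_self F t i)))

end FullSupport

section CondExp

variable {Ω : Type*} {m : MeasurableSpace Ω} [MeasurableSingletonClass Ω]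
  {P : Measure Ω} [IsProbabilityMeasure P]

lemma condExp_linearCombination [Finite Ω] (hP : ∀ i, 0 < P {i}) (m₀ : MeasurableSpace Ω) (a b : ℝ)
    (f g : Ω → ℝ) : P[a • f + b • g | m₀] = a • P[f | m₀] + b • P[g | m₀] :=
  eq_of_ae_eq_of_forall_pos hP
    ((condExp_add Integrable.of_finite Integrable.of_finite m₀).trans
      ((condExp_smul a f m₀).add (condExp_smul b g m₀)))

variable [Fintype Ω]

open Classical in
lemma setIntegral_eq_sum (f : Ω → ℝ) (A : Set Ω) :
    ∫ x in A, f x ∂P = ∑ x with x ∈ A, P.real {x} * f x := by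
  rw [← integral_indicator (Set.toFinite A).measurableSet,
    integral_fintype Integrable.of_finite, Finset.sum_filter]
  exact Finset.sum_congr rfl fun x _ => by by_cases hx : x ∈ A <;> simp [hx]

open Classical in
lemma sum_stageNode_eq_zero_of_condExp {F : Filtration ℕ m} {t : ℕ} {f : Ω → ℝ}
    (h : P[f | F t] = 0) (i : Ω) : ∑ x with x ∈ stageNode F t i, P.real {x} * f x = 0 := by
  rw [← setIntegral_eq_sum, ← setIntegral_condExp (F.le t) Integrable.of_finite
    (measurableSet_stageNode t i), h]
  simp

open Classical in
/-- The fluctuation of the indicator of the leaf `i` around its average over the node of stage `t`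
above `i`. -/
noncomputable def leafFluctuation (F : Filtration ℕ m) (P : Measure Ω) (t : ℕ) (i : Ω) : Ω → ℝ :=
  fun x => (if x = i then 1 else 0) -
    if x ∈ stageNode F t i then P.real {i} / P.real (stageNode F t i) else 0

lemma condExp_leafFluctuation (hP : ∀ i, 0 < P {i}) (F : Filtration ℕ m) (t : ℕ) (i : Ω) :
    P[leafFluctuation F P t i | F t] = 0 := by
  classical
  refine (eq_of_ae_eq_of_forall_pos hP (ae_eq_condExp_of_forall_setIntegral_eq (F.le t)
    Integrable.of_finite (fun _ _ _ => integrableOn_zero) (fun s hs _ => ?_)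
    aestronglyMeasurable_zero)).symm
  have hpos := real_stageNode_pos hP F t i
  have key : ∑ x with x ∈ stageNode F t i, P.real {x} = P.real (stageNode F t i) := by
    simp
  simp only [integral_zero]
  rw [setIntegral_eq_sum]
  simp only [leafFluctuation, mul_sub, Finset.sum_sub_distrib, mul_ite, mul_one, mul_zero]
  by_cases hi : i ∈ s
  · -- the set `s` contains the whole node above `i`
    have hsub := stageNode_subset hs hi
    rw [Finset.sum_ite_eq' _ i, if_pos (by simp [hi]), ← Finset.sum_filter,
      Finset.filter_filter, ← Finset.sum_mul,
      Finset.filter_congr (q := fun x => x ∈ stageNode F t i) fun x _ =>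
        ⟨fun h => h.2, fun h => ⟨hsub h, h⟩⟩, key]
    field_simp
    simp
  · -- the set `s` misses the whole node above `i`
    have hsub : stageNode F t i ⊆ sᶜ := stageNode_subset (MeasurableSet.compl hs) hi
    rw [Finset.sum_ite_eq' _ i, if_neg (by simp [hi]), Finset.sum_eq_zero, sub_zero]
    intro x hx
    rw [if_neg fun h => hsub h (by simpa using hx)]

end CondExp

/-! ### Terminal values of dual processes -/

section Dual

variable {Ω Ω' : Type*} {m : MeasurableSpace Ω} {m' : MeasurableSpace Ω'}
  {T : ℕ} {F : Filtration ℕ m} {F' : Filtration ℕ m'} {P : Measure Ω} {P' : Measure Ω'}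

/-- Exchanging the two trees exchanges the summands `β` and `γ` of a dual process. -/
lemma IsDualProcess.swap {M₀ : ℝ} {M : ℕ → Ω × Ω' → ℝ} (h : IsDualProcess T F F' P P' M₀ M) :
    IsDualProcess T F' F P' P M₀ fun t z => M t z.swap := by
  obtain ⟨β, γ, h1, h2⟩ := h
  refine ⟨fun t z => γ t z.swap, fun t z => β t z.swap, fun t ht => ?_, fun t ht z => ?_⟩
  · obtain ⟨hβ, hβ0, hγ, hγ0⟩ := h1 t ht
    refine ⟨hγ.comp (@measurable_swap _ _ (F' t) (F (t - 1))), ?_,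
      hβ.comp (@measurable_swap _ _ (F' (t - 1)) (F t)), ?_⟩
    · funext z; exact congrFun hγ0 z.swap
    · funext z; exact congrFun hβ0 z.swap
  · simp only [h2 t ht, add_comm]

lemma projLeft_zero (t : ℕ) : projLeft F P t (0 : Ω × Ω' → ℝ) = 0 :=
  funext fun z => congrFun (condExp_zero (m := F t) (μ := P) (E := ℝ)) z.1

lemma projRight_zero (t : ℕ) : projRight F' P' t (0 : Ω × Ω' → ℝ) = 0 :=
  funext fun z => congrFun (condExp_zero (m := F' t) (μ := P') (E := ℝ)) z.2

lemma projLeft_linearCombination [Finite Ω] [MeasurableSingletonClass Ω] [IsProbabilityMeasure P]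
    (hP : ∀ i, 0 < P {i}) (t : ℕ) (a b : ℝ) (f g : Ω × Ω' → ℝ) :
    projLeft F P t (a • f + b • g) = a • projLeft F P t f + b • projLeft F P t g := by
  funext z
  exact congrFun (condExp_linearCombination hP (F t) a b
    (fun x => f (x, z.2)) (fun x => g (x, z.2))) z.1

lemma projRight_linearCombination [Finite Ω'] [MeasurableSingletonClass Ω']
    [IsProbabilityMeasure P'] (hP' : ∀ j, 0 < P' {j}) (t : ℕ) (a b : ℝ) (f g : Ω × Ω' → ℝ) :
    projRight F' P' t (a • f + b • g) = a • projRight F' P' t f + b • projRight F' P' t g := by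
  funext z
  exact congrFun (condExp_linearCombination hP' (F' t) a b
    (fun y => f (z.1, y)) (fun y => g (z.1, y))) z.2

lemma isDualProcess_const (c : ℝ) : IsDualProcess T F F' P P' c fun _ _ => c :=
  ⟨0, 0, fun t _ => ⟨measurable_const, projLeft_zero _, measurable_const, projRight_zero _⟩,
    by simp⟩

variable [Finite Ω] [Finite Ω'] [MeasurableSingletonClass Ω] [MeasurableSingletonClass Ω']
  [IsProbabilityMeasure P] [IsProbabilityMeasure P']

lemma IsDualProcess.linearCombination (hP : ∀ i, 0 < P {i}) (hP' : ∀ j, 0 < P' {j})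
    {M₀ N₀ : ℝ} {M N : ℕ → Ω × Ω' → ℝ} (hM : IsDualProcess T F F' P P' M₀ M)
    (hN : IsDualProcess T F F' P P' N₀ N) (a b : ℝ) :
    IsDualProcess T F F' P P' (a * M₀ + b * N₀) (a • M + b • N) := by
  obtain ⟨β, γ, h1, h2⟩ := hM
  obtain ⟨β', γ', h1', h2'⟩ := hN
  refine ⟨a • β + b • β', a • γ + b • γ', fun t ht => ?_, fun t ht z => ?_⟩
  · obtain ⟨hβ, hβ0, hγ, hγ0⟩ := h1 t ht
    obtain ⟨hβ', hβ0', hγ', hγ0'⟩ := h1' t ht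
    refine ⟨(hβ.const_smul a).add (hβ'.const_smul b), ?_,
      (hγ.const_smul a).add (hγ'.const_smul b), ?_⟩
    · simpa [hβ0, hβ0'] using projLeft_linearCombination (F := F) hP (t - 1) a b (β t) (β' t)
    · simpa [hγ0, hγ0'] using projRight_linearCombination (F' := F') hP' (t - 1) a b (γ t) (γ' t)
  · simp only [Pi.add_apply, Pi.smul_apply, smul_eq_mul, h2 t ht, h2' t ht, mul_add,
      Finset.mul_sum, Finset.sum_add_distrib]
    ring

/-- The functions `M T` that are terminal values of dual processes `M`, with any starting value. -/
def dualTerminalValues (T : ℕ) (F : Filtration ℕ m) (F' : Filtration ℕ m')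
    (hP : ∀ i, 0 < P {i}) (hP' : ∀ j, 0 < P' {j}) : Submodule ℝ (Ω × Ω' → ℝ) where
  carrier := {f | ∃ M₀ M, IsDualProcess T F F' P P' M₀ M ∧ M T = f}
  add_mem' := by
    rintro _ _ ⟨M₀, M, hM, rfl⟩ ⟨N₀, N, hN, rfl⟩
    exact ⟨_, _, hM.linearCombination hP hP' hN 1 1, by simp⟩
  smul_mem' := by
    rintro c _ ⟨M₀, M, hM, rfl⟩
    exact ⟨_, _, hM.linearCombination hP hP' hM c 0, by simp⟩
  zero_mem' := ⟨0, _, isDualProcess_const 0, rfl⟩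

lemma const_mem_dualTerminalValues (hP : ∀ i, 0 < P {i}) (hP' : ∀ j, 0 < P' {j}) (c : ℝ) :
    (fun _ => c) ∈ dualTerminalValues T F F' hP hP' :=
  ⟨c, _, isDualProcess_const c, rfl⟩

lemma swap_mem_dualTerminalValues {hP : ∀ i, 0 < P {i}} {hP' : ∀ j, 0 < P' {j}}
    {f : Ω × Ω' → ℝ} (hf : f ∈ dualTerminalValues T F F' hP hP') :
    (fun z => f z.swap) ∈ dualTerminalValues T F' F hP' hP := by
  obtain ⟨M₀, M, hM, rfl⟩ := hf
  exact ⟨M₀, _, hM.swap, rfl⟩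

/-- A product `g(x) k(y)` with `E (g ∣ F t) = 0` and `k` measurable for `F' t` is attained by the
martingale differences of `g`: these vanish up to time `t`, and after time `t` the factor `k` is
known one step in advance. -/
lemma mul_mem_dualTerminalValues (hP : ∀ i, 0 < P {i}) (hP' : ∀ j, 0 < P' {j}) (hFT : F T = m)
    {t : ℕ} {g : Ω → ℝ} {k : Ω' → ℝ} (hg : P[g | F t] = 0) (hk : Measurable[F' t] k) :
    (fun z : Ω × Ω' => g z.1 * k z.2) ∈ dualTerminalValues T F F' hP hP' := by
  have hzero : ∀ s ≤ t, P[g | F s] = 0 := fun s hs => by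
    rw [← condExp_condExp hP F hs, hg, condExp_zero]
  set a : ℕ → Ω → ℝ := fun s => P[g | F s] with ha
  have haT : a T = g := condExp_of_stronglyMeasurable (F.le T)
    (by rw [hFT]; exact (measurable_of_countable g).stronglyMeasurable) Integrable.of_finite
  have hmeas : ∀ s, Measurable[F s] (a s) := fun s => stronglyMeasurable_condExp.measurable
  have htel : ∀ u x, ∑ s ∈ Finset.Icc 1 u, (a s x - a (s - 1) x) = a u x := by
    intro u x
    induction u with
    | zero => simp [ha, hzero 0 t.zero_le]
    | succ u ih => rw [Finset.sum_Icc_succ_top (by lia), ih]; simp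
  refine ⟨0, fun u z => a u z.1 * k z.2, ⟨fun s z => (a s z.1 - a (s - 1) z.1) * k z.2, 0,
    fun s hs => ⟨?_, ?_, measurable_const, ?_⟩, fun u _ z => ?_⟩, by simp [haT]⟩
  · rcases le_or_gt s t with hst | hst
    · simp only [ha, hzero s hst, hzero (s - 1) (by lia), sub_self, Pi.zero_apply, zero_mul]
      exact measurable_const
    · refine Measurable.mul (Measurable.sub ?_ ?_) ?_
      · exact (hmeas s).comp (@measurable_fst _ _ (F s) (F' (s - 1)))
      · exact ((hmeas (s - 1)).mono (F.mono (Nat.sub_le s 1)) le_rfl).comp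
          (@measurable_fst _ _ (F s) (F' (s - 1)))
      · exact (hk.mono (F'.mono (by lia)) le_rfl).comp
          (@measurable_snd _ _ (F s) (F' (s - 1)))
  · funext z
    have h := condExp_linearCombination hP (F (s - 1)) (k z.2) (-k z.2) (a s) (a (s - 1))
    have h1 : P[a s | F (s - 1)] = a (s - 1) := condExp_condExp hP F (Nat.sub_le s 1) g
    have h2 : P[a (s - 1) | F (s - 1)] = a (s - 1) := condExp_condExp hP F le_rfl g
    have h3 : (fun x => (a s x - a (s - 1) x) * k z.2)
        = k z.2 • a s + -k z.2 • a (s - 1) := by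
      funext x
      simp only [Pi.add_apply, Pi.smul_apply, smul_eq_mul]
      ring
    simp only [projLeft, h3, h, h1, h2]
    simp
  · exact projRight_zero _
  · simp only [Pi.zero_apply, add_zero, zero_add, ← Finset.sum_mul, htel]

end Dual

/-! ### Nested plans as solutions of linear equations -/

section Plans

variable {Ω Ω' : Type*} [Fintype Ω] [Fintype Ω']

lemma nodeMass_flip (π : Ω → Ω' → ℝ) (A : Set Ω) (B : Set Ω') :
    nodeMass (flip π) B A = nodeMass π A B :=
  Finset.sum_comm

lemma nodeMass_linearCombination (a b : ℝ) (π ρ : Ω → Ω' → ℝ) (A : Set Ω) (B : Set Ω') :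
    nodeMass (a • π + b • ρ) A B = a * nodeMass π A B + b * nodeMass ρ A B := by
  simp [nodeMass, Finset.sum_add_distrib, Finset.mul_sum]

variable {m : MeasurableSpace Ω} {m' : MeasurableSpace Ω'}
  {T : ℕ} {F : Filtration ℕ m} {F' : Filtration ℕ m'} {P : Measure Ω} {P' : Measure Ω'}

lemma nodeMass_stageNode_pos {π : Ω → Ω' → ℝ} (hπ : ∀ i j, 0 < π i j) (t : ℕ) (i : Ω) (j : Ω') :
    0 < nodeMass π (stageNode F t i) (stageNode F' t j) :=
  Finset.sum_pos (fun x _ => Finset.sum_pos (fun y _ => hπ x y)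
    ⟨j, by simpa using mem_stageNode_self F' t j⟩) ⟨i, by simpa using mem_stageNode_self F t i⟩

open Classical in
/-- The constraint on the first marginal at stage `t`, multiplied by the masses of the pairs of
nodes. In this form it is linear in `π` and makes sense for matrices that are not positive. The
constraint on the second marginal is that of the transposed matrix. -/
def IsNodeBalanced (F : Filtration ℕ m) (F' : Filtration ℕ m') (P : Measure Ω) (t : ℕ)
    (π : Ω → Ω' → ℝ) : Prop :=
  ∀ i j, ∑ y with y ∈ stageNode F' t j, π i y
    = P.real {i} / P.real (stageNode F t i) * nodeMass π (stageNode F t i) (stageNode F' t j)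

lemma IsNodeBalanced.linearCombination {t : ℕ} {π ρ : Ω → Ω' → ℝ}
    (hπ : IsNodeBalanced F F' P t π) (hρ : IsNodeBalanced F F' P t ρ) (a b : ℝ) :
    IsNodeBalanced F F' P t (a • π + b • ρ) := by
  intro i j
  simp only [nodeMass_linearCombination, Pi.add_apply, Pi.smul_apply, smul_eq_mul,
    Finset.sum_add_distrib, ← Finset.mul_sum, hπ i j, hρ i j]
  ring

open Classical in
lemma isNodeBalanced_iff_of_pos {π : Ω → Ω' → ℝ} (hπ : ∀ i j, 0 < π i j) (t : ℕ) :
    IsNodeBalanced F F' P t π ↔ ∀ i j,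
      ∑ y with y ∈ stageNode F' t j, condPlan π (stageNode F t i) (stageNode F' t j) i y
        = P.real {i} / P.real (stageNode F t i) := by
  refine forall₂_congr fun i j => ?_
  simp only [condPlan, ← Finset.sum_div]
  rw [div_eq_iff (nodeMass_stageNode_pos hπ t i j).ne']

/-- The relaxation of `IsNestedPlan` that allows vanishing entries, which makes the feasible set
compact. -/
structure IsRelaxedNestedPlan (T : ℕ) (F : Filtration ℕ m) (F' : Filtration ℕ m')
    (P : Measure Ω) (P' : Measure Ω') (π : Ω → Ω' → ℝ) : Prop where
  nonneg : ∀ i j, 0 ≤ π i j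
  sum_eq_one : ∑ i, ∑ j, π i j = 1
  left : ∀ t ≤ T, IsNodeBalanced F F' P t π
  right : ∀ t ≤ T, IsNodeBalanced F' F P' t (flip π)

lemma isNestedPlan_iff {π : Ω → Ω' → ℝ} :
    IsNestedPlan T F F' P P' π ↔ (∀ i j, 0 < π i j) ∧ IsRelaxedNestedPlan T F F' P P' π := by
  have key (hπ : ∀ i j, 0 < π i j) (t : ℕ) := isNodeBalanced_iff_of_pos (F := F') (F' := F)
    (P := P') (π := flip π) (fun i j => hπ j i) t
  simp only [condPlan, nodeMass_flip] at key
  constructor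
  · intro h
    exact ⟨h.pos, fun i j => (h.pos i j).le, h.sum_eq_one,
      fun t ht => (isNodeBalanced_iff_of_pos h.pos t).mpr (h.left_marginal t ht),
      fun t ht => (key h.pos t).mpr fun j i => h.right_marginal t ht i j⟩
  · rintro ⟨hpos, h⟩
    exact ⟨hpos, h.sum_eq_one,
      fun t ht => (isNodeBalanced_iff_of_pos hpos t).mp (h.left t ht),
      fun t ht i j => (key hpos t).mp (h.right t ht) j i⟩

/-- Independent couplings are nested. -/
lemma isNodeBalanced_prod [MeasurableSingletonClass Ω] [IsProbabilityMeasure P]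
    (hP : ∀ i, 0 < P {i}) (t : ℕ) (q : Ω' → ℝ) :
    IsNodeBalanced F F' P t fun i j => P.real {i} * q j := by
  classical
  intro i j
  have key : ∑ x with x ∈ stageNode F t i, P.real {x} = P.real (stageNode F t i) := by
    simp
  have hpos := real_stageNode_pos hP F t i
  simp only [nodeMass, ← Finset.mul_sum, ← Finset.sum_mul, key]
  field_simp

lemma isRelaxedNestedPlan_prod [MeasurableSingletonClass Ω] [MeasurableSingletonClass Ω']
    [IsProbabilityMeasure P] [IsProbabilityMeasure P']
    (hP : ∀ i, 0 < P {i}) (hP' : ∀ j, 0 < P' {j}) :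
    IsRelaxedNestedPlan T F F' P P' fun i j => P.real {i} * P'.real {j} where
  nonneg i j := by positivity
  sum_eq_one := by simp [← Finset.mul_sum]
  left t _ := isNodeBalanced_prod hP t _
  right t _ := by
    have : (flip fun i j => P.real {i} * P'.real {j}) = fun j i => P'.real {j} * P.real {i} :=
      funext₂ fun _ _ => mul_comm _ _
    rw [this]
    exact isNodeBalanced_prod hP' t _

lemma IsRelaxedNestedPlan.add_smul {π h : Ω → Ω' → ℝ} (hπ : IsRelaxedNestedPlan T F F' P P' π)
    (hl : ∀ t ≤ T, IsNodeBalanced F F' P t h) (hr : ∀ t ≤ T, IsNodeBalanced F' F P' t (flip h))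
    (h0 : ∑ i, ∑ j, h i j = 0) (s : ℝ) (hs : ∀ i j, 0 ≤ π i j + s * h i j) :
    IsRelaxedNestedPlan T F F' P P' ((1 : ℝ) • π + s • h) where
  nonneg i j := by simpa using hs i j
  sum_eq_one := by simp [Finset.sum_add_distrib, ← Finset.mul_sum, h0, hπ.sum_eq_one]
  left t ht := (hπ.left t ht).linearCombination (hl t ht) 1 s
  right t ht := (hπ.right t ht).linearCombination (hr t ht) 1 s

lemma IsRelaxedNestedPlan.convexCombination {π ρ : Ω → Ω' → ℝ}
    (hπ : IsRelaxedNestedPlan T F F' P P' π) (hρ : IsRelaxedNestedPlan T F F' P P' ρ)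
    {a b : ℝ} (ha : 0 ≤ a) (hb : 0 ≤ b) (hab : a + b = 1) :
    IsRelaxedNestedPlan T F F' P P' (a • π + b • ρ) where
  nonneg i j := add_nonneg (mul_nonneg ha (hπ.nonneg i j)) (mul_nonneg hb (hρ.nonneg i j))
  sum_eq_one := by
    simp [Finset.sum_add_distrib, ← Finset.mul_sum, hπ.sum_eq_one, hρ.sum_eq_one, hab]
  left t ht := (hπ.left t ht).linearCombination (hρ.left t ht) a b
  right t ht := (hπ.right t ht).linearCombination (hρ.right t ht) a b

lemma isCompact_setOf_isRelaxedNestedPlan :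
    IsCompact {π : Ω → Ω' → ℝ | IsRelaxedNestedPlan T F F' P P' π} := by
  have hsub : {π : Ω → Ω' → ℝ | IsRelaxedNestedPlan T F F' P P' π} ⊆ Set.Icc 0 1 := by
    refine fun π h => ⟨h.nonneg, fun i j => ?_⟩
    rw [Pi.one_apply, Pi.one_apply, ← h.sum_eq_one]
    exact (Finset.single_le_sum (f := fun j => π i j) (fun j _ => h.nonneg i j)
      (Finset.mem_univ j)).trans (Finset.single_le_sum (f := fun i => ∑ j, π i j)
        (fun i _ => Finset.sum_nonneg fun j _ => h.nonneg i j) (Finset.mem_univ i))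
  refine isCompact_Icc.of_isClosed_subset ?_ hsub
  have : {π : Ω → Ω' → ℝ | IsRelaxedNestedPlan T F F' P P' π}
      = {π | (∀ i j, 0 ≤ π i j) ∧ ∑ i, ∑ j, π i j = 1 ∧
        (∀ t ≤ T, IsNodeBalanced F F' P t π) ∧ ∀ t ≤ T, IsNodeBalanced F' F P' t (flip π)} :=
    Set.ext fun π => ⟨fun h => ⟨h.1, h.2, h.3, h.4⟩, fun h => ⟨h.1, h.2.1, h.2.2.1, h.2.2.2⟩⟩
  rw [this]
  simp only [Set.ofPred_and, Set.ofPred_forall, IsNodeBalanced, nodeMass, flip]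
  refine .inter ?_ (.inter ?_ (.inter ?_ ?_))
  · exact isClosed_iInter fun i => isClosed_iInter fun j =>
      isClosed_le continuous_const (by fun_prop)
  · exact isClosed_eq (by fun_prop) continuous_const
  all_goals exact isClosed_iInter fun t => isClosed_iInter fun _ => isClosed_iInter fun i =>
    isClosed_iInter fun j => isClosed_eq (by fun_prop) (by fun_prop)

end Plans

/-! ### Weak duality -/

section WeakDuality

variable {Ω Ω' : Type*} [Fintype Ω] [Fintype Ω'] {m : MeasurableSpace Ω} {m' : MeasurableSpace Ω'}
  {T : ℕ} {F : Filtration ℕ m} {F' : Filtration ℕ m'} {P : Measure Ω} {P' : Measure Ω'}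
  [MeasurableSingletonClass Ω] [IsProbabilityMeasure P]

/-- On a pair of nodes of stage `t` the increment depends on the first leaf only, and there the
plan has a first marginal proportional to `P`; so the plan integrates the increment to zero. -/
lemma IsNodeBalanced.sum_mul_eq_zero {t u : ℕ} {π : Ω → Ω' → ℝ}
    (hπ : IsNodeBalanced F F' P t π) {β : Ω × Ω' → ℝ} (hβ : Measurable[(F u).prod (F' t)] β)
    (h0 : projLeft F P t β = 0) : ∑ i, ∑ j, π i j * β (i, j) = 0 := by
  classical
  rw [Finset.sum_comm]
  refine sum_eq_zero_of_forall_stageNode (F := F') t fun j => ?_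
  rw [Finset.sum_comm]
  refine sum_eq_zero_of_forall_stageNode (F := F) t fun i => ?_
  have hj : P[fun x => β (x, j) | F t] = 0 := funext fun x => congrFun h0 (x, j)
  have hsum := sum_stageNode_eq_zero_of_condExp hj i
  rw [← mul_zero (nodeMass π (stageNode F t i) (stageNode F' t j) / P.real (stageNode F t i)),
    ← hsum, Finset.mul_sum]
  refine Finset.sum_congr rfl fun x hx => ?_
  have hx : stageNode F t x = stageNode F t i := stageNode_eq_of_mem (by simpa using hx)
  have hslice : Measurable[F' t] fun y => β (x, y) :=
    hβ.comp (@measurable_prodMk_left _ _ (F u) (F' t) x)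
  rw [Finset.sum_congr rfl fun y hy => by
    rw [eq_of_mem_stageNode hslice (by simpa using hy : y ∈ stageNode F' t j)],
    ← Finset.sum_mul, hπ x j, hx]
  ring

variable [MeasurableSingletonClass Ω'] [IsProbabilityMeasure P']

/-- Every nested plan turns every dual process into one with constant mean. -/
lemma IsRelaxedNestedPlan.sum_mul_terminalValue {π : Ω → Ω' → ℝ}
    (hπ : IsRelaxedNestedPlan T F F' P P' π) {M₀ : ℝ} {M : ℕ → Ω × Ω' → ℝ}
    (hM : IsDualProcess T F F' P P' M₀ M) : ∑ i, ∑ j, π i j * M T (i, j) = M₀ := by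
  obtain ⟨β, γ, h1, h2⟩ := hM
  have hβ : ∀ s ∈ Finset.Icc 1 T, ∑ i, ∑ j, π i j * β s (i, j) = 0 := fun s hs =>
    (hπ.left (s - 1) (by simp at hs; lia)).sum_mul_eq_zero (h1 s hs).1 (h1 s hs).2.1
  have hγ : ∀ s ∈ Finset.Icc 1 T, ∑ i, ∑ j, π i j * γ s (i, j) = 0 := fun s hs => by
    rw [Finset.sum_comm]
    exact (hπ.right (s - 1) (by simp at hs; lia)).sum_mul_eq_zero
      (β := fun z => γ s z.swap)
      ((h1 s hs).2.2.1.comp (@measurable_swap _ _ (F' s) (F (s - 1))))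
      (funext fun z => congrFun (h1 s hs).2.2.2 z.swap)
  have hsplit : ∑ i, ∑ j, π i j * M T (i, j) = (∑ i, ∑ j, π i j) * M₀
      + ∑ s ∈ Finset.Icc 1 T,
        ((∑ i, ∑ j, π i j * β s (i, j)) + ∑ i, ∑ j, π i j * γ s (i, j)) := by
    simp only [h2 T le_rfl, mul_add, Finset.mul_sum, Finset.sum_mul, Finset.sum_add_distrib]
    congr 1
    congr 1
    all_goals
      exact (Finset.sum_congr rfl fun i _ => Finset.sum_comm).trans Finset.sum_comm
  rw [hsplit, hπ.sum_eq_one, Finset.sum_eq_zero fun s hs => by rw [hβ s hs, hγ s hs, add_zero]]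
  ring

/-- Gibbs' inequality: the entropy of the plan relative to the dual probability is nonnegative. -/
lemma le_entropicCost_add {l r : ℝ} (hl : 0 < l) {d : Ω → Ω' → ℝ} {π : Ω → Ω' → ℝ}
    (hπ : IsNestedPlan T F F' P P' π) {M₀ : ℝ} (hM₀ : M₀ ∈ dualStartValues T F F' P P' l r d) :
    M₀ ≤ entropicCost l r d π + 1 / l := by
  obtain ⟨M, hM, -, hq⟩ := hM₀
  rw [Fintype.sum_prod_type] at hq
  have hmean := (isNestedPlan_iff.mp hπ).2.sum_mul_terminalValue hM
  have hterm : ∀ i j, 1 / l * (π i j - Real.exp (-l * (d i j ^ r - M T (i, j)) - 1))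
      ≤ (π i j * d i j ^ r + 1 / l * (π i j * Real.log (π i j))) - π i j * M T (i, j)
        + 1 / l * π i j := fun i j => by
    have hp := hπ.pos i j
    have h := Real.add_one_le_exp (-l * (d i j ^ r - M T (i, j)) - 1 - Real.log (π i j))
    rw [Real.exp_sub, Real.exp_log hp, le_div_iff₀ hp] at h
    have : 1 / l * (π i j - Real.exp (-l * (d i j ^ r - M T (i, j)) - 1))
      ≤ 1 / l * (π i j - (-l * (d i j ^ r - M T (i, j)) - 1 - Real.log (π i j) + 1) * π i j) := by
      gcongr
    refine this.trans (le_of_eq ?_)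
    field_simp
    ring
  have := Finset.sum_le_sum fun i (_ : i ∈ Finset.univ) =>
    Finset.sum_le_sum fun j (_ : j ∈ Finset.univ) => hterm i j
  simp only [Finset.sum_add_distrib, Finset.sum_sub_distrib, ← Finset.mul_sum, hmean,
    hπ.sum_eq_one, hq] at this
  simp only [entropicCost, Finset.sum_add_distrib, ← Finset.mul_sum]
  linarith

end WeakDuality

/-! ### The primal minimizer -/

section Minimizer

variable {Ω Ω' : Type*} [Fintype Ω] [Fintype Ω'] {m : MeasurableSpace Ω} {m' : MeasurableSpace Ω'}
  {T : ℕ} {F : Filtration ℕ m} {F' : Filtration ℕ m'} {P : Measure Ω} {P' : Measure Ω'}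

/-- The minimizer has no vanishing entry: towards a positive plan, the entropy has slope `-∞`
there. -/
lemma IsRelaxedNestedPlan.pos_of_isMinOn {l r : ℝ} (hl : 0 < l) {d π p : Ω → Ω' → ℝ}
    (hπ : IsRelaxedNestedPlan T F F' P P' π)
    (hmin : ∀ ρ, IsRelaxedNestedPlan T F F' P P' ρ → entropicCost l r d π ≤ entropicCost l r d ρ)
    (hp : IsRelaxedNestedPlan T F F' P P' p) (hpos : ∀ i j, 0 < p i j) (i : Ω) (j : Ω') :
    0 < π i j := by
  classical
  refine (hπ.nonneg i j).lt_of_ne' fun h0 => ?_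
  set D := entropicCost l r d p - entropicCost l r d π with hD
  -- at the weight `exp (-N)` the gain in entropy, of order `N`, exceeds the difference `D` of costs
  set N := l * (|D| + 1) / p i j with hN
  have hpij := hpos i j
  have hNpos : 0 < N := by positivity
  set ε := Real.exp (-N) with hε
  have hε0 : 0 < ε := Real.exp_pos _
  have hε1 : ε < 1 := Real.exp_zero ▸ Real.exp_lt_exp.mpr (by linarith)
  have hle := hmin _ (hπ.convexCombination hp (sub_nonneg.mpr hε1.le) hε0.le (by ring))
  have hterm : ∀ x y, ((1 - ε) • π + ε • p) x y * Real.log (((1 - ε) • π + ε • p) x y)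
      ≤ (1 - ε) * (π x y * Real.log (π x y)) + ε * (p x y * Real.log (p x y))
        + if x = i then if y = j then -(ε * p i j * N) else 0 else 0 := fun x y => by
    by_cases hxy : x = i ∧ y = j
    · obtain ⟨rfl, rfl⟩ := hxy
      simp only [Pi.add_apply, Pi.smul_apply, smul_eq_mul, h0, mul_zero, zero_mul, zero_add,
        if_true]
      rw [Real.log_mul hε0.ne' hpij.ne', hε, Real.log_exp]
      exact le_of_eq (by ring)
    · have h := Real.convexOn_mul_log.2 (hπ.nonneg x y) (hpos x y).le
        (sub_nonneg.mpr hε1.le) hε0.le (by ring)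
      have hite : (if x = i then if y = j then -(ε * p i j * N) else 0 else 0) = 0 := by
        split_ifs <;> simp_all
      simpa [hite] using h
  have hsum : entropicCost l r d ((1 - ε) • π + ε • p)
      ≤ (1 - ε) * entropicCost l r d π + ε * entropicCost l r d p
        + 1 / l * -(ε * p i j * N) := by
    have h : ∀ x y, ((1 - ε) • π + ε • p) x y * d x y ^ r
        + 1 / l * (((1 - ε) • π + ε • p) x y * Real.log (((1 - ε) • π + ε • p) x y))
        ≤ (1 - ε) * (π x y * d x y ^ r + 1 / l * (π x y * Real.log (π x y)))
          + ε * (p x y * d x y ^ r + 1 / l * (p x y * Real.log (p x y)))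
          + 1 / l * if x = i then if y = j then -(ε * p i j * N) else 0 else 0 := fun x y => by
      have := mul_le_mul_of_nonneg_left (hterm x y) (one_div_pos.mpr hl).le
      simp only [Pi.add_apply, Pi.smul_apply, smul_eq_mul] at this ⊢
      linarith
    refine (Finset.sum_le_sum fun x _ => Finset.sum_le_sum fun y _ => h x y).trans (le_of_eq ?_)
    simp only [entropicCost, Finset.sum_add_distrib, ← Finset.mul_sum, Finset.sum_ite_irrel,
      Finset.sum_const_zero, Finset.sum_ite_eq', Finset.mem_univ, if_true]
  have hNl : 1 / l * -(ε * p i j * N) = -(ε * (|D| + 1)) := by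
    rw [hN]
    field_simp
  have hfin : 0 ≤ ε * (D - (|D| + 1)) := by
    rw [hNl] at hsum
    linarith
  have := nonneg_of_mul_nonneg_right hfin hε0
  linarith [le_abs_self D]

/-- The infimum of the primal problem is attained. -/
lemma exists_isNestedPlan_forall_le [MeasurableSingletonClass Ω] [MeasurableSingletonClass Ω']
    [IsProbabilityMeasure P] [IsProbabilityMeasure P']
    (hP : ∀ i, 0 < P {i}) (hP' : ∀ j, 0 < P' {j}) {l : ℝ} (hl : 0 < l) (r : ℝ) (d : Ω → Ω' → ℝ) :
    ∃ π, IsNestedPlan T F F' P P' π ∧ ∀ ρ, IsRelaxedNestedPlan T F F' P P' ρ →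
      entropicCost l r d π ≤ entropicCost l r d ρ := by
  have hp := isRelaxedNestedPlan_prod (T := T) (F := F) (F' := F') hP hP'
  have hcont : Continuous (entropicCost l r d) := by
    have h := Real.continuous_mul_log
    refine continuous_finsetSum _ fun i _ => continuous_finsetSum _ fun j _ =>
      .add (by fun_prop) (continuous_const.mul (h.comp (g := fun x => x * Real.log x)
        (f := fun π : Ω → Ω' → ℝ => π i j) (by fun_prop)))
  obtain ⟨π, hπ, hmin⟩ := isCompact_setOf_isRelaxedNestedPlan.exists_isMinOn ⟨_, hp⟩
    hcont.continuousOn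
  exact ⟨π, isNestedPlan_iff.mpr ⟨hπ.pos_of_isMinOn hl (fun ρ hρ => hmin hρ) hp fun i j =>
    mul_pos (ENNReal.toReal_pos (hP i).ne' (measure_ne_top _ _))
      (ENNReal.toReal_pos (hP' j).ne' (measure_ne_top _ _)), hπ⟩, fun ρ hρ => hmin hρ⟩

/-- The gradient of the objective at the plan `π`. -/
noncomputable def costGradient (l r : ℝ) (d π : Ω → Ω' → ℝ) : Ω × Ω' → ℝ :=
  fun z => d z.1 z.2 ^ r + 1 / l * (Real.log (π z.1 z.2) + 1)

lemma hasDerivAt_entropicCost {l r : ℝ} {d π : Ω → Ω' → ℝ} (hπ : ∀ i j, 0 < π i j)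
    (h : Ω → Ω' → ℝ) :
    HasDerivAt (fun s : ℝ => entropicCost l r d ((1 : ℝ) • π + s • h))
      (∑ i, ∑ j, h i j * costGradient l r d π (i, j)) 0 := by
  refine HasDerivAt.fun_sum fun i _ => HasDerivAt.fun_sum fun j _ => ?_
  have hlin : HasDerivAt (fun s : ℝ => ((1 : ℝ) • π + s • h) i j) (h i j) 0 := by
    simpa using ((hasDerivAt_id (0 : ℝ)).mul_const (h i j)).const_add (π i j)
  have hval : ((1 : ℝ) • π + (0 : ℝ) • h) i j = π i j := by simp
  have hlog : HasDerivAt (fun x : ℝ => x * Real.log x) (Real.log (π i j) + 1)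
      (((1 : ℝ) • π + (0 : ℝ) • h) i j) := by
    rw [hval]
    exact Real.hasDerivAt_mul_log (hπ i j).ne'
  refine ((hlin.mul_const (d i j ^ r)).add ((hlog.comp 0 hlin).const_mul (1 / l))).congr_deriv ?_
  rw [costGradient]
  ring

/-- Stationarity of the minimizer along the directions that preserve the constraints. -/
lemma IsNestedPlan.sum_mul_costGradient_eq_zero {l r : ℝ} {d π h : Ω → Ω' → ℝ}
    (hπ : IsNestedPlan T F F' P P' π)
    (hmin : ∀ ρ, IsRelaxedNestedPlan T F F' P P' ρ → entropicCost l r d π ≤ entropicCost l r d ρ)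
    (hl : ∀ t ≤ T, IsNodeBalanced F F' P t h) (hr : ∀ t ≤ T, IsNodeBalanced F' F P' t (flip h))
    (h0 : ∑ i, ∑ j, h i j = 0) : ∑ i, ∑ j, h i j * costGradient l r d π (i, j) = 0 := by
  refine IsLocalMin.hasDerivAt_eq_zero ?_ (hasDerivAt_entropicCost hπ.pos h)
  have hev : ∀ᶠ s : ℝ in nhds 0, ∀ i j, 0 < π i j + s * h i j := by
    refine Filter.eventually_all.mpr fun i => Filter.eventually_all.mpr fun j => ?_
    have hc : Continuous fun s : ℝ => π i j + s * h i j := by fun_prop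
    exact hc.continuousAt.eventually_const_lt (by simpa using hπ.pos i j)
  filter_upwards [hev] with s hs
  simpa using hmin _ ((isNestedPlan_iff.mp hπ).2.add_smul hl hr h0 s fun i j => (hs i j).le)

end Minimizer

/-! ### Strong duality -/

section StrongDuality

variable {Ω Ω' : Type*} [Fintype Ω] [Fintype Ω'] {m : MeasurableSpace Ω} {m' : MeasurableSpace Ω'}
  {T : ℕ} {F : Filtration ℕ m} {F' : Filtration ℕ m'} {P : Measure Ω} {P' : Measure Ω'}
  [MeasurableSingletonClass Ω] [MeasurableSingletonClass Ω']
  [IsProbabilityMeasure P] [IsProbabilityMeasure P']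

/-- A matrix that annihilates all terminal values satisfies the marginal constraints, because the
linear forms that define these constraints are themselves terminal values. -/
lemma isNodeBalanced_of_forall_mem (hP : ∀ i, 0 < P {i}) (hP' : ∀ j, 0 < P' {j}) (hFT : F T = m)
    {h : Ω → Ω' → ℝ}
    (hh : ∀ f ∈ dualTerminalValues T F F' hP hP', ∑ i, ∑ j, h i j * f (i, j) = 0) (t : ℕ) :
    IsNodeBalanced F F' P t h := by
  classical
  intro i j
  have hk : Measurable[F' t] ((stageNode F' t j).indicator fun _ => (1 : ℝ)) :=
    measurable_const.indicator (measurableSet_stageNode t j)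
  have := hh _ (mul_mem_dualTerminalValues hP hP' hFT (condExp_leafFluctuation hP F t i) hk)
  have hinner : ∀ x, ∑ y, h x y * (leafFluctuation F P t i x *
      (stageNode F' t j).indicator (fun _ => (1 : ℝ)) y)
      = leafFluctuation F P t i x * ∑ y with y ∈ stageNode F' t j, h x y := fun x => by
    rw [Finset.sum_filter, Finset.mul_sum]
    refine Finset.sum_congr rfl fun y _ => ?_
    by_cases hy : y ∈ stageNode F' t j <;> simp [hy, mul_comm]
  simp only [hinner] at this
  simp only [leafFluctuation, sub_mul, ite_mul, one_mul, zero_mul,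
    Finset.sum_sub_distrib, Finset.sum_ite_eq', Finset.mem_univ, if_true, ← Finset.sum_filter,
    ← Finset.mul_sum] at this
  exact sub_eq_zero.mp this

/-- A function that annihilates all directions preserving the constraints is a terminal value:
otherwise some matrix annihilates all terminal values but not this function, and such a matrix is
a direction preserving the constraints. -/
lemma mem_dualTerminalValues_of_forall (hP : ∀ i, 0 < P {i}) (hP' : ∀ j, 0 < P' {j})
    (hFT : F T = m) (hF'T : F' T = m') {G : Ω × Ω' → ℝ}
    (hG : ∀ h : Ω → Ω' → ℝ, (∀ t ≤ T, IsNodeBalanced F F' P t h) →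
      (∀ t ≤ T, IsNodeBalanced F' F P' t (flip h)) → ∑ i, ∑ j, h i j = 0 →
      ∑ i, ∑ j, h i j * G (i, j) = 0) : G ∈ dualTerminalValues T F F' hP hP' := by
  classical
  by_contra hGS
  obtain ⟨φ, hφG, hφ⟩ := Submodule.exists_dual_map_eq_bot_of_notMem hGS inferInstance
  -- the matrix that represents the separating functional
  set h : Ω → Ω' → ℝ := fun i j => φ (Pi.single (i, j) 1) with hh
  have hφh : ∀ f, φ f = ∑ i, ∑ j, h i j * f (i, j) := fun f => by
    rw [LinearMap.pi_apply_eq_sum_univ φ f, Fintype.sum_prod_type]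
    refine Finset.sum_congr rfl fun i _ => Finset.sum_congr rfl fun j _ => ?_
    rw [smul_eq_mul, mul_comm]
    congr 2
    funext z
    simp [Pi.single_apply, eq_comm]
  have hvan : ∀ f ∈ dualTerminalValues T F F' hP hP', ∑ i, ∑ j, h i j * f (i, j) = 0 :=
    fun f hf => by
      rw [← hφh]
      exact (Submodule.eq_bot_iff _).mp hφ _ (Submodule.mem_map_of_mem hf)
  refine hφG ((hφh G).trans (hG h (fun t _ => isNodeBalanced_of_forall_mem hP hP' hFT hvan t)
    (fun t _ => isNodeBalanced_of_forall_mem hP' hP hF'T (fun f hf => ?_) t) ?_))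
  · rw [Finset.sum_comm]
    exact hvan _ (swap_mem_dualTerminalValues hf)
  · simpa using hvan _ (const_mem_dualTerminalValues hP hP' 1)

/-- A minimizing plan is the probability of the dual process that ends in the gradient of the
objective. -/
lemma IsNestedPlan.add_mem_dualStartValues (hP : ∀ i, 0 < P {i}) (hP' : ∀ j, 0 < P' {j})
    (hFT : F T = m) (hF'T : F' T = m') {l r : ℝ} (hl : 0 < l) {d π : Ω → Ω' → ℝ}
    (hπ : IsNestedPlan T F F' P P' π)
    (hmin : ∀ ρ, IsRelaxedNestedPlan T F F' P P' ρ →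
      entropicCost l r d π ≤ entropicCost l r d ρ) :
    entropicCost l r d π + 1 / l ∈ dualStartValues T F F' P P' l r d := by
  obtain ⟨M₀, M, hM, hMT⟩ := mem_dualTerminalValues_of_forall hP hP' hFT hF'T
    (G := costGradient l r d π) fun h h1 h2 h3 => hπ.sum_mul_costGradient_eq_zero hmin h1 h2 h3
  have hexp : ∀ z : Ω × Ω',
      Real.exp (-l * (d z.1 z.2 ^ r - M T z) - 1) = π z.1 z.2 := fun z => by
    rw [hMT, costGradient, ← Real.exp_log (hπ.pos z.1 z.2)]
    congr 1
    rw [Real.log_exp]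
    field_simp
    ring
  have hM₀ : entropicCost l r d π + 1 / l = M₀ := by
    rw [← (isNestedPlan_iff.mp hπ).2.sum_mul_terminalValue hM, hMT]
    have hone : 1 / l = ∑ i, ∑ j, 1 / l * π i j := by
      simp only [← Finset.mul_sum, hπ.sum_eq_one, mul_one]
    conv_lhs => rw [hone, entropicCost]
    simp only [← Finset.sum_add_distrib, costGradient]
    exact Finset.sum_congr rfl fun i _ => Finset.sum_congr rfl fun j _ => by ring
  refine ⟨M, hM₀ ▸ hM, fun z => (Real.exp_pos _).le, ?_⟩
  simp only [hexp]
  rw [Fintype.sum_prod_type, hπ.sum_eq_one]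

end StrongDuality

/-- Duality for the nested Sinkhorn divergence including the entropy. The first conjunct says that
the primal problem has a finite infimum over a nonempty feasible set. -/
theorem mainTheorem2 {Ω Ω' : Type*} [Fintype Ω] [Fintype Ω']
    [m : MeasurableSpace Ω] [m' : MeasurableSpace Ω']
    [MeasurableSingletonClass Ω] [MeasurableSingletonClass Ω']
    (T : ℕ) (F : Filtration ℕ m) (F' : Filtration ℕ m')
    (hF0 : F 0 = ⊥) (hF'0 : F' 0 = ⊥) (hFT : F T = m) (hF'T : F' T = m')
    (P : Measure Ω) (P' : Measure Ω') [IsProbabilityMeasure P] [IsProbabilityMeasure P']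
    (hP : ∀ i, 0 < P {i}) (hP' : ∀ j, 0 < P' {j})
    (d : Ω → Ω' → ℝ) (r : ℝ) (hr : 1 ≤ r) (l : ℝ) (hl : 0 < l) :
    IsGLB (nestedSinkhornValues T F F' P P' l r d) (nestedSinkhorn T F F' P P' l r d) ∧
      IsLUB (dualStartValues T F F' P P' l r d)
        (nestedSinkhorn T F F' P P' l r d + 1 / l) := by
  obtain ⟨π, hπ, hmin⟩ :=
    exists_isNestedPlan_forall_le (T := T) (F := F) (F' := F') hP hP' hl r d
  have hleast : IsLeast (nestedSinkhornValues T F F' P P' l r d) (entropicCost l r d π) :=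
    ⟨⟨π, hπ, rfl⟩, by rintro _ ⟨ρ, hρ, rfl⟩; exact hmin ρ (isNestedPlan_iff.mp hρ).2⟩
  rw [nestedSinkhorn, hleast.csInf_eq]
  exact ⟨hleast.isGLB, IsGreatest.isLUB
    ⟨hπ.add_mem_dualStartValues hP hP' hFT hF'T hl hmin, fun M₀ hM₀ =>
      le_entropicCost_add hl hπ hM₀⟩⟩
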